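/- **Corollary (Magic positivity and determinants).** For $\mathbf{y}=(y_1,\dots,y_n)\in\mathbb{Z}_{>0}^n$, the polynomial \[ p_{\mathbf{y}}(t)=\det\left[\frac{1}{(j-i+1)!}\prod_{\ell=0}^{j-i}\bigl(1-\ell+t\,(y_1+\cdots+y_i-1+\ell)\bigr)\right]_{i,j=1}^n\in\mathbb{R}[t] \] has nonnegative coefficients. Here the $(i,j)$ entry is $1$ if $j-i+1=0$ and $0$ if $j-i+1<0$. Moreover, this matrix is obtained by applying the magic transform to each entry of the Pitman–Stanley matrix $\left[\binom{t(y_1+\cdots+y_i)+1}{j-i+1}\right]_{i,j=1}^n$: for $d=j-i+1\ge 0$, the $(i,j)$ entry above is $\mathscr{M}_d\binom{t(y_1+\cdots+y_i)+1}{d}$, and both $(i,j)$ entries are $0$ if $j-i+1<0$. Here $\binom{u}{d}=\frac{1}{d!}u(u-1)\cdots(u-d+1)$, and for a polynomial $p(t)=\sum_{i=0}^d c_i\,t^i(1+t)^{d-i}$ its magic transform is $\mathscr{M}_d(p)=\sum_{i=0}^d c_i\,t^i$. -/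

import Mathlib

open Polynomial

noncomputable section

/-- The partial sum `y_1 + ⋯ + y_i` (coordinates are indexed by `Fin n`, so that the
usual index `i ∈ {1, …, n}` is the element `i - 1` of `Fin n`). -/
def partialSum {n : ℕ} (y : Fin n → ℤ) (i : Fin n) : ℤ :=
  ∑ k ∈ Finset.Iic i, y k

/-- The polynomial `binom(a t + b, c) = (1 / c!) ∏_{ℓ=0}^{c-1} (a t + b - ℓ)` in `ℝ[t]`. -/
def binomialPoly (a b : ℤ) (c : ℕ) : ℝ[X] :=
  C ((c.factorial : ℝ)⁻¹) * ∏ ℓ ∈ Finset.range c, (C (a : ℝ) * X + C ((b : ℝ) - (ℓ : ℝ)))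

/-- The `(i, j)` entry of the matrix in the determinantal formula for the Ehrhart polynomial of the
Pitman-Stanley polytope: `binom(t (y_1 + ⋯ + y_i) + 1, j - i + 1)`, which is zero when
`j - i + 1 < 0`. -/
def pitmanStanleyEntry {n : ℕ} (y : Fin n → ℤ) (i j : Fin n) : ℝ[X] :=
  if (i : ℕ) ≤ (j : ℕ) + 1 then binomialPoly (partialSum y i) 1 ((j : ℕ) + 1 - (i : ℕ)) else 0

/-- `q` is the magic transform `M_d(p)`: if `p = ∑_{i=0}^d c_i t^i (1 + t)^{d-i}`, then
`M_d(p) = ∑_{i=0}^d c_i t^i`. -/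
def IsMagicTransform (d : ℕ) (p q : ℝ[X]) : Prop :=
  ∃ c : ℕ → ℝ,
    p = ∑ i ∈ Finset.range (d + 1), C (c i) * X ^ i * (1 + X) ^ (d - i) ∧
    q = ∑ i ∈ Finset.range (d + 1), C (c i) * X ^ i

/-- The matrix with `(i, j)` entry
`(1 / (j - i + 1)!) ∏_{ℓ=0}^{j-i} (1 - ℓ + t (y_1 + ⋯ + y_i - 1 + ℓ))`, where the entry is `1` if
`j - i + 1 = 0` (empty product) and `0` if `j - i + 1 < 0`. -/
def magicMatrix {n : ℕ} (y : Fin n → ℤ) : Matrix (Fin n) (Fin n) ℝ[X] :=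
  Matrix.of fun i j =>
    if (i : ℕ) ≤ (j : ℕ) + 1 then
      C ((((j : ℕ) + 1 - (i : ℕ)).factorial : ℝ)⁻¹) *
        ∏ ℓ ∈ Finset.range ((j : ℕ) + 1 - (i : ℕ)),
          (C (1 - (ℓ : ℝ)) + X * C ((partialSum y i : ℝ) - 1 + (ℓ : ℝ)))
    else 0

/-- The polynomial `p_y(t)`. -/
def magicDet {n : ℕ} (y : Fin n → ℤ) : ℝ[X] :=
  (magicMatrix y).det

end

/-! Put q = 1 - t, s_i = y_1 + ⋯ + y_i and u_i = 1 + t (s_i - 1). The factors of an entry are u_i -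
ℓ q, so up to the sign (-1)^d the entry is the coefficient of z^d in (1 - q z)^(u_i/q). By
`Matrix.det_hessenberg_eq` the determinant is then the coefficient D_n in 1 = ∑ D_i z^i (1 - q
z)^(u_i/q), with i now counted from 0.

Write u_i = (q + t) + i t + ε_0 + ⋯ + ε_i, where ε_m = t (y - 1) for the m-th coordinate y, and set
Z = z (1 - q z)^(t/q). The expansion becomes (1 - q z)^(-(q+t)/q) = ∑ D_i Z^i (1 - q
z)^((ε_0+⋯+ε_i)/q). The D_i are found by repeatedly multiplying by (1 - q z)^(-ε_k/q), reading off
the constant term in Z, and dividing the rest by Z. By Lagrange inversion (`subst_abelSeries`), (1 -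
q z)^(-x/q) has coefficients in Z that are nonnegative combinations of products of x, t and q + t
(`abelCoeff_mem`). Nothing is ever subtracted, and t, q + t = 1 and ε_m all have nonnegative
coefficients; hence so does D_n. -/

/-- The coefficient of `z ^ d` in `(1 - q z) ^ (-x / q)`. -/
noncomputable def risingCoeff {K : Type*} [CommRing K] [Algebra ℚ K] (q x : K) (d : ℕ) : K :=
  algebraMap ℚ K ((d.factorial : ℚ)⁻¹) * ∏ ℓ ∈ Finset.range d, (x + ℓ * q)

/-- The power series `(1 - q z) ^ (-x / q)`. -/
noncomputable def risingSeries {K : Type*} [CommRing K] [Algebra ℚ K] (q x : K) : PowerSeries K :=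
  PowerSeries.mk (risingCoeff q x)

/-- The coefficient of `Z ^ n` in the expansion of `(1 - q z) ^ (-x / q)` in powers of
`Z = z (1 - q z) ^ (t / q)`. -/
noncomputable def abelCoeff {K : Type*} [CommRing K] [Algebra ℚ K] (q t x : K) : ℕ → K
  | 0 => 1
  | n + 1 => algebraMap ℚ K (((n + 1).factorial : ℚ)⁻¹) *
      (x * ∏ ℓ ∈ Finset.range n, (x + (n + 1) * t + (ℓ + 1) * q))

/-- The expansion of `(1 - q z) ^ (-x / q)` in powers of `Z = z (1 - q z) ^ (t / q)`. -/
noncomputable def abelSeries {K : Type*} [CommRing K] [Algebra ℚ K] (q t x : K) : PowerSeries K :=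
  PowerSeries.mk (abelCoeff q t x)

/-! ### Powers of 1 - q z and their difference equations -/

section Series

variable {K : Type*} [CommRing K] [Algebra ℚ K] (q t x y : K)

lemma algebraMap_inv_factorial_succ (d : ℕ) :
    ((d : K) + 1) * algebraMap ℚ K (((d + 1).factorial : ℚ)⁻¹) =
      algebraMap ℚ K ((d.factorial : ℚ)⁻¹) := by
  have h : ((d : K) + 1) = algebraMap ℚ K ((d : ℚ) + 1) := by simp
  rw [h, ← map_mul]
  congr 1
  have := d.factorial_ne_zero
  rw [Nat.factorial_succ]
  push_cast
  field_simp

lemma natCast_succ_mul_cancel (d : ℕ) {a b : K} (h : ((d : K) + 1) * a = ((d : K) + 1) * b) :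
    a = b := by
  have h1 : algebraMap ℚ K ((d : ℚ) + 1)⁻¹ * ((d : K) + 1) = 1 := by
    have h : ((d : K) + 1) = algebraMap ℚ K ((d : ℚ) + 1) := by simp
    rw [h, ← map_mul, inv_mul_cancel₀ (by positivity), map_one]
  calc a = algebraMap ℚ K ((d : ℚ) + 1)⁻¹ * ((d : K) + 1) * a := by rw [h1, one_mul]
    _ = algebraMap ℚ K ((d : ℚ) + 1)⁻¹ * ((d : K) + 1) * b := by rw [mul_assoc, h, ← mul_assoc]
    _ = b := by rw [h1, one_mul]

@[simp]
lemma risingCoeff_zero : risingCoeff q x 0 = 1 := by simp [risingCoeff]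

lemma succ_mul_risingCoeff_succ (d : ℕ) :
    ((d : K) + 1) * risingCoeff q x (d + 1) = (x + d * q) * risingCoeff q x d := by
  rw [risingCoeff, risingCoeff, ← mul_assoc, algebraMap_inv_factorial_succ,
    Finset.prod_range_succ]
  ring

/-- The equation (1 - q z) f' = x f is a first-order recursion on coefficients, solvable because n +
1 is invertible. Identities between powers of 1 - q z are reduced to it. -/
lemma eq_risingSeries {f : PowerSeries K} (h0 : PowerSeries.constantCoeff f = 1)
    (h : PowerSeries.derivative K f = PowerSeries.C x * f +
      PowerSeries.C q * (PowerSeries.X * PowerSeries.derivative K f)) :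
    f = risingSeries q x := by
  ext n
  induction n with
  | zero => simpa [risingSeries] using h0
  | succ n ih =>
    refine natCast_succ_mul_cancel n ?_
    rw [risingSeries, PowerSeries.coeff_mk, succ_mul_risingCoeff_succ]
    rw [risingSeries, PowerSeries.coeff_mk] at ih
    have hn := congrArg (PowerSeries.coeff n) h
    rw [PowerSeries.coeff_derivative, map_add, PowerSeries.coeff_C_mul, PowerSeries.coeff_C_mul,
      ih] at hn
    have hx : PowerSeries.coeff n (PowerSeries.X * PowerSeries.derivative K f) =
        n * risingCoeff q x n := by
      cases n with
      | zero => simp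
      | succ m =>
        rw [PowerSeries.coeff_succ_X_mul, PowerSeries.coeff_derivative, ih]
        push_cast
        ring
    rw [hx] at hn
    linear_combination hn

lemma constantCoeff_risingSeries : PowerSeries.constantCoeff (risingSeries q x) = 1 := by
  simp [risingSeries, ← PowerSeries.coeff_zero_eq_constantCoeff_apply]

lemma derivative_risingSeries :
    PowerSeries.derivative K (risingSeries q x) = PowerSeries.C x * risingSeries q x +
      PowerSeries.C q * (PowerSeries.X * PowerSeries.derivative K (risingSeries q x)) := by
  ext n
  rw [map_add, PowerSeries.coeff_C_mul, PowerSeries.coeff_C_mul, PowerSeries.coeff_derivative]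
  simp only [risingSeries, PowerSeries.coeff_mk]
  have h := succ_mul_risingCoeff_succ q x n
  cases n with
  | zero =>
    simp only [PowerSeries.coeff_zero_X_mul]
    linear_combination h
  | succ m =>
    rw [PowerSeries.coeff_succ_X_mul, PowerSeries.coeff_derivative, PowerSeries.coeff_mk]
    push_cast at h ⊢
    linear_combination h

lemma risingSeries_add :
    risingSeries q (x + y) = risingSeries q x * risingSeries q y := by
  symm
  apply eq_risingSeries
  · simp [constantCoeff_risingSeries]
  · rw [Derivation.leibniz, smul_eq_mul, smul_eq_mul, map_add]
    linear_combination risingSeries q y * derivative_risingSeries q x +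
      risingSeries q x * derivative_risingSeries q y

lemma risingSeries_zero : risingSeries q 0 = 1 := by
  symm
  apply eq_risingSeries <;> simp

lemma risingSeries_neg_self :
    risingSeries q (-q) = 1 - PowerSeries.C q * PowerSeries.X := by
  symm
  apply eq_risingSeries
  · simp
  · have : PowerSeries.derivative K (1 - PowerSeries.C q * PowerSeries.X) = -PowerSeries.C q := by
      simp
    rw [this, map_neg]
    ring

lemma risingSeries_sub_risingSeries :
    risingSeries q x - risingSeries q (x - q) =
      PowerSeries.C q * (PowerSeries.X * risingSeries q x) := by
  rw [sub_eq_add_neg x q, risingSeries_add, risingSeries_neg_self]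
  ring

lemma risingSeries_nsmul (n : ℕ) : risingSeries q x ^ n = risingSeries q (n * x) := by
  induction n with
  | zero => simp [risingSeries_zero]
  | succ n ih =>
    rw [pow_succ, ih, ← risingSeries_add]
    congr 1
    push_cast
    ring

/-- Counterpart in Z of `risingSeries_sub_risingSeries`: the shift of x by t compensates for Z = z
(1 - q z)^(t/q). -/
lemma abelSeries_sub_abelSeries :
    abelSeries q t x - abelSeries q t (x - q) =
      PowerSeries.C q * (PowerSeries.X * abelSeries q t (x + t)) := by
  ext n
  rw [map_sub, PowerSeries.coeff_C_mul]
  cases n with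
  | zero => simp [abelSeries, abelCoeff]
  | succ n =>
    rw [PowerSeries.coeff_succ_X_mul]
    simp only [abelSeries, PowerSeries.coeff_mk]
    cases n with
    | zero => simp [abelCoeff]
    | succ i =>
      simp only [abelCoeff]
      rw [← algebraMap_inv_factorial_succ (i + 1), Finset.prod_range_succ,
        Finset.prod_range_succ']
      have h1 : ∀ ℓ ∈ Finset.range i,
          x - q + (((i + 1 : ℕ) : K) + 1) * t + (((ℓ + 1 : ℕ) : K) + 1) * q =
            x + (((i + 1 : ℕ) : K) + 1) * t + ((ℓ : K) + 1) * q := by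
        intros; push_cast; ring
      have h2 : ∀ ℓ ∈ Finset.range i,
          x + t + ((i : K) + 1) * t + ((ℓ : K) + 1) * q =
            x + (((i + 1 : ℕ) : K) + 1) * t + ((ℓ : K) + 1) * q := by
        intros; push_cast; ring
      rw [Finset.prod_congr rfl h1, Finset.prod_congr rfl h2]
      push_cast
      ring

lemma exists_eval_eq_risingCoeff (n : ℕ) : ∃ p : K[X], ∀ x, risingCoeff q x n = p.eval x :=
  ⟨C (algebraMap ℚ K ((n.factorial : ℚ)⁻¹)) * ∏ ℓ ∈ Finset.range n, (X + C (ℓ * q)), fun x => by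
    simp only [risingCoeff, eval_mul, eval_C, eval_prod, eval_add, eval_X]⟩

lemma exists_eval_eq_abelCoeff (n : ℕ) : ∃ p : K[X], ∀ x, abelCoeff q t x n = p.eval x := by
  cases n with
  | zero => exact ⟨1, fun x => by simp [abelCoeff]⟩
  | succ n =>
    exact ⟨C (algebraMap ℚ K (((n + 1).factorial : ℚ)⁻¹)) *
      (X * ∏ ℓ ∈ Finset.range n, (X + C ((n + 1) * t) + C ((ℓ + 1) * q))), fun x => by
        simp only [abelCoeff, eval_mul, eval_C, eval_prod, eval_add, eval_X]⟩

/-- The power series `Z = z (1 - q z) ^ (t / q)`. -/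
noncomputable def abelVar : PowerSeries K := PowerSeries.X * risingSeries q (-t)

lemma hasSubst_abelVar : PowerSeries.HasSubst (abelVar q t) :=
  PowerSeries.HasSubst.of_constantCoeff_zero' (by simp [abelVar])

lemma abelVar_pow (n : ℕ) : abelVar q t ^ n = PowerSeries.X ^ n * risingSeries q (-(n * t)) := by
  rw [abelVar, mul_pow, risingSeries_nsmul, mul_neg]

lemma coeff_subst_abelVar (f : PowerSeries K) (n : ℕ) :
    PowerSeries.coeff n (f.subst (abelVar q t)) =
      ∑ d ∈ Finset.range (n + 1), PowerSeries.coeff d f *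
        PowerSeries.coeff n (abelVar q t ^ d) := by
  rw [PowerSeries.coeff_subst' (hasSubst_abelVar q t), finsum_eq_sum_of_support_subset
    (s := Finset.range (n + 1))]
  · simp
  · intro d hd
    rw [Function.mem_support] at hd
    by_contra hlt
    simp only [Finset.coe_range, Set.mem_Iio, not_lt] at hlt
    apply hd
    rw [abelVar_pow, PowerSeries.coeff_X_pow_mul', if_neg (by omega), smul_zero]

lemma subst_abelSeries_sub :
    (abelSeries q t x).subst (abelVar q t) - (abelSeries q t (x - q)).subst (abelVar q t) =
      PowerSeries.C q * (PowerSeries.X * (risingSeries q (-t) *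
        (abelSeries q t (x + t)).subst (abelVar q t))) := by
  have hs := hasSubst_abelVar q t
  have h := congrArg (PowerSeries.substAlgHom (R := K) hs) (abelSeries_sub_abelSeries q t x)
  have hC : PowerSeries.substAlgHom (R := K) hs (PowerSeries.C q) = PowerSeries.C q := by
    simpa using (PowerSeries.substAlgHom (R := K) hs).commutes q
  rw [map_sub, map_mul, map_mul, hC, PowerSeries.substAlgHom_X] at h
  simp only [PowerSeries.coe_substAlgHom] at h
  rw [h, abelVar]
  ring

end Series

/-! ### Lagrange inversion -/

lemma Polynomial.eq_zero_of_periodic {K : Type*} [CommRing K] [IsDomain K] [CharZero K] {q : K}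
    (hq : q ≠ 0) {p : K[X]} (h0 : p.eval 0 = 0) (h : ∀ x, p.eval x = p.eval (x - q)) : p = 0 := by
  apply Polynomial.eq_zero_of_infinite_isRoot
  refine Set.infinite_of_injective_forall_mem (f := fun n : ℕ => -(n * q)) ?_ ?_
  · intro a b hab
    simpa [hq] using hab
  · intro n
    induction n with
    | zero => simpa using h0
    | succ n ih =>
      have := h (-(n * q))
      simp only [Set.mem_ofPred_eq, IsRoot] at ih ⊢
      rw [ih] at this
      rw [this]
      congr 1
      push_cast
      ring

/-- A form of Lagrange inversion: the expansion of `(1 - q z) ^ (-x / q)` in powers of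
`z (1 - q z) ^ (t / q)`. -/
theorem subst_abelSeries {K : Type*} [CommRing K] [IsDomain K] [Algebra ℚ K] {q : K} (hq : q ≠ 0)
    (t x : K) : (abelSeries q t x).subst (abelVar q t) = risingSeries q x := by
  have : CharZero K := algebraRat.charZero K
  suffices h : ∀ n x, PowerSeries.coeff n ((abelSeries q t x).subst (abelVar q t)) =
      PowerSeries.coeff n (risingSeries q x) by
    ext n
    exact h n x
  intro n
  induction n using Nat.strong_induction_on with
  | _ n ih =>
  cases n with
  | zero =>
    intro x
    rw [coeff_subst_abelVar]
    simp [abelSeries, risingSeries, abelCoeff]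
  | succ n =>
    choose p hp using exists_eval_eq_abelCoeff q t
    obtain ⟨r, hr⟩ := exists_eval_eq_risingCoeff q (n + 1)
    -- For fixed degree, the difference of the two coefficients is polynomial in x. It vanishes at x
    -- = 0 and has period q, so it is zero.
    set g : K[X] := ∑ d ∈ Finset.range (n + 1 + 1),
      p d * C (PowerSeries.coeff (n + 1) (abelVar q t ^ d)) - r with hg
    have key : ∀ x, g.eval x = PowerSeries.coeff (n + 1) ((abelSeries q t x).subst (abelVar q t)) -
        PowerSeries.coeff (n + 1) (risingSeries q x) := by
      intro x
      rw [coeff_subst_abelVar]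
      simp [hg, eval_finsetSum, abelSeries, risingSeries, hp, hr]
    have hg0 : g = 0 := by
      refine Polynomial.eq_zero_of_periodic hq ?_ ?_
      · have h1 : abelSeries q t 0 = 1 := by
          ext m
          cases m <;> simp [abelSeries, abelCoeff, PowerSeries.coeff_one]
        have h2 : (1 : PowerSeries K).subst (abelVar q t) = (1 : PowerSeries K) := by
          rw [← PowerSeries.coe_substAlgHom (hasSubst_abelVar q t), map_one]
        rw [key, h1, h2, risingSeries_zero, sub_self]
      · intro x
        rw [key, key]
        have e1 := congrArg (PowerSeries.coeff (n + 1)) (subst_abelSeries_sub q t x)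
        have e2 := congrArg (PowerSeries.coeff (n + 1)) (risingSeries_sub_risingSeries q x)
        have e3 : PowerSeries.coeff n (risingSeries q (-t) *
            (abelSeries q t (x + t)).subst (abelVar q t)) =
            PowerSeries.coeff n (risingSeries q x) := by
          have hx : risingSeries q x = risingSeries q (-t) * risingSeries q (x + t) := by
            rw [← risingSeries_add]
            congr 1
            ring
          rw [hx, PowerSeries.coeff_mul, PowerSeries.coeff_mul]
          refine Finset.sum_congr rfl fun ij hij => ?_
          -- The factor z lowers the degree by one, so the induction hypothesis applies, at x + t;
          -- hence the induction is over all x at once.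
          rw [ih ij.2 (by have := Finset.HasAntidiagonal.mem_antidiagonal.mp hij; omega)]
        rw [map_sub, PowerSeries.coeff_C_mul, PowerSeries.coeff_succ_X_mul] at e1 e2
        rw [e3, ← e2] at e1
        linear_combination e1
    intro x
    have := key x
    rw [hg0, eval_zero] at this
    exact (sub_eq_zero.mp this.symm)

/-! ### Positivity of the coefficients in Z -/

lemma PowerSeries.coeff_mul_mem {K : Type*} [CommRing K] (S : Subsemiring K) {f g : PowerSeries K}
    (hf : ∀ n, PowerSeries.coeff n f ∈ S) (hg : ∀ n, PowerSeries.coeff n g ∈ S) (n : ℕ) :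
    PowerSeries.coeff n (f * g) ∈ S := by
  rw [PowerSeries.coeff_mul]
  exact S.sum_mem fun ij _ => S.mul_mem (hf _) (hg _)

lemma abelCoeff_mem {K : Type*} [CommRing K] [Algebra ℚ K] (S : Subsemiring K)
    (hS : ∀ r : ℚ, 0 ≤ r → algebraMap ℚ K r ∈ S) {q t x : K} (ht : t ∈ S) (hqt : q + t ∈ S)
    (hx : x ∈ S) (n : ℕ) : abelCoeff q t x n ∈ S := by
  cases n with
  | zero => exact S.one_mem
  | succ n =>
    refine S.mul_mem (hS _ (by positivity)) (S.mul_mem hx (S.prod_mem fun ℓ hℓ => ?_))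
    obtain ⟨m, rfl⟩ := Nat.exists_eq_add_of_lt (Finset.mem_range.mp hℓ)
    -- q itself need not lie in `S`; each q is paired with one of the t's, which are numerous
    -- enough.
    have : x + (((ℓ + m + 1 : ℕ) : K) + 1) * t + ((ℓ : K) + 1) * q =
        x + ((m + 1 : ℕ) : K) * t + ((ℓ + 1 : ℕ) : K) * (q + t) := by
      push_cast
      ring
    rw [this]
    exact S.add_mem (S.add_mem hx (S.mul_mem (natCast_mem S _) ht))
      (S.mul_mem (natCast_mem S _) hqt)

/-! ### The coefficients D_i -/

section Expansion

variable {K : Type*} [CommRing K] [Algebra ℚ K] (q t : K) (ε : ℕ → K)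

/-- The remainders of the expansion of `(1 - q z) ^ (-(q + t) / q)` as
`∑ D_i Z ^ i (1 - q z) ^ ((ε_0 + ⋯ + ε_i) / q)`, as power series in `Z`. -/
noncomputable def remainderSeries : ℕ → PowerSeries K
  | 0 => abelSeries q t (q + t)
  | k + 1 => PowerSeries.mk fun p =>
      PowerSeries.coeff (p + 1) (remainderSeries k * abelSeries q t (ε k))

/-- The coefficients `D_i` of the expansion of `(1 - q z) ^ (-(q + t) / q)` as
`∑ D_i Z ^ i (1 - q z) ^ ((ε_0 + ⋯ + ε_i) / q)`. -/
noncomputable def expansionCoeff (k : ℕ) : K :=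
  PowerSeries.constantCoeff (remainderSeries q t ε k * abelSeries q t (ε k))

variable {q t ε}

lemma coeff_remainderSeries_mem (S : Subsemiring K)
    (hS : ∀ r : ℚ, 0 ≤ r → algebraMap ℚ K r ∈ S) (ht : t ∈ S) (hqt : q + t ∈ S)
    (hε : ∀ i, ε i ∈ S) (k n : ℕ) : PowerSeries.coeff n (remainderSeries q t ε k) ∈ S := by
  induction k generalizing n with
  | zero =>
    rw [remainderSeries, abelSeries, PowerSeries.coeff_mk]
    exact abelCoeff_mem S hS ht hqt hqt n
  | succ k ih =>
    rw [remainderSeries, PowerSeries.coeff_mk]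
    refine PowerSeries.coeff_mul_mem S ih (fun m => ?_) _
    rw [abelSeries, PowerSeries.coeff_mk]
    exact abelCoeff_mem S hS ht hqt (hε k) m

lemma expansionCoeff_mem (S : Subsemiring K)
    (hS : ∀ r : ℚ, 0 ≤ r → algebraMap ℚ K r ∈ S) (ht : t ∈ S) (hqt : q + t ∈ S)
    (hε : ∀ i, ε i ∈ S) (k : ℕ) : expansionCoeff q t ε k ∈ S := by
  rw [expansionCoeff, ← PowerSeries.coeff_zero_eq_constantCoeff_apply]
  refine PowerSeries.coeff_mul_mem S (coeff_remainderSeries_mem S hS ht hqt hε k) (fun m => ?_) _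
  rw [abelSeries, PowerSeries.coeff_mk]
  exact abelCoeff_mem S hS ht hqt (hε k) m

lemma subst_remainderSeries_mul [IsDomain K] (hq : q ≠ 0) (k : ℕ) :
    (remainderSeries q t ε k).subst (abelVar q t) * risingSeries q (ε k) =
      PowerSeries.C (expansionCoeff q t ε k) +
        abelVar q t * (remainderSeries q t ε (k + 1)).subst (abelVar q t) := by
  have hs := hasSubst_abelVar q t
  have h := congrArg (PowerSeries.substAlgHom (R := K) hs)
    (PowerSeries.eq_X_mul_shift_add_const (remainderSeries q t ε k * abelSeries q t (ε k)))
  have hC : ∀ c, PowerSeries.substAlgHom (R := K) hs (PowerSeries.C c) = PowerSeries.C c :=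
    fun c => by simpa using (PowerSeries.substAlgHom (R := K) hs).commutes c
  rw [map_add, map_mul, map_mul, hC, PowerSeries.substAlgHom_X] at h
  simp only [PowerSeries.coe_substAlgHom, subst_abelSeries hq] at h
  rw [h, add_comm]
  rfl

lemma risingSeries_eq_sum_expansionCoeff [IsDomain K] (hq : q ≠ 0) (k : ℕ) :
    risingSeries q (q + t) =
      ∑ i ∈ Finset.range k, PowerSeries.C (expansionCoeff q t ε i) *
        (PowerSeries.X ^ i * risingSeries q (-(i * t + ∑ m ∈ Finset.range (i + 1), ε m))) +
      PowerSeries.X ^ k * (risingSeries q (-(k * t + ∑ m ∈ Finset.range k, ε m)) *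
        (remainderSeries q t ε k).subst (abelVar q t)) := by
  induction k with
  | zero => simp [risingSeries_zero, remainderSeries, subst_abelSeries hq]
  | succ k ih =>
    have h1 : risingSeries q (-(k * t + ∑ m ∈ Finset.range k, ε m)) =
        risingSeries q (-(k * t + ∑ m ∈ Finset.range (k + 1), ε m)) * risingSeries q (ε k) := by
      rw [← risingSeries_add, Finset.sum_range_succ]
      congr 1
      ring
    have h2 : risingSeries q (-(((k + 1 : ℕ) : K) * t + ∑ m ∈ Finset.range (k + 1), ε m)) =
        risingSeries q (-(k * t + ∑ m ∈ Finset.range (k + 1), ε m)) * risingSeries q (-t) := by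
      rw [← risingSeries_add]
      congr 1
      push_cast
      ring
    have h3 := subst_remainderSeries_mul (t := t) (ε := ε) hq k
    rw [abelVar] at h3
    rw [abelVar] at ih
    rw [ih, h1, Finset.sum_range_succ (fun i => PowerSeries.C (expansionCoeff q t ε i) * _), h2,
      abelVar]
    linear_combination PowerSeries.X ^ k *
      risingSeries q (-(k * t + ∑ m ∈ Finset.range (k + 1), ε m)) * h3

/-- Divide the expansion by its left side and compare coefficients of z^n; after n + 1 steps the
remainder is divisible by z^(n+1) and drops out. -/
lemma sum_expansionCoeff_mul_risingCoeff [IsDomain K] (hq : q ≠ 0) (n : ℕ) :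
    ∑ i ∈ Finset.range (n + 1), expansionCoeff q t ε i *
      risingCoeff q (-(q + t + i * t + ∑ m ∈ Finset.range (i + 1), ε m)) (n - i) =
      if n = 0 then 1 else 0 := by
  have h := congrArg (· * risingSeries q (-(q + t)))
    (risingSeries_eq_sum_expansionCoeff (t := t) (ε := ε) hq (n + 1))
  simp only [← risingSeries_add, add_neg_cancel, risingSeries_zero, add_mul, Finset.sum_mul] at h
  have hn := congrArg (PowerSeries.coeff n) h
  rw [map_add, map_sum, mul_assoc (PowerSeries.X ^ (n + 1)), PowerSeries.coeff_X_pow_mul',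
    if_neg (by omega), add_zero, PowerSeries.coeff_one] at hn
  rw [hn]
  refine Finset.sum_congr rfl fun i hi => ?_
  rw [mul_assoc, mul_assoc, ← risingSeries_add, PowerSeries.coeff_C_mul,
    PowerSeries.coeff_X_pow_mul', if_pos (by have := Finset.mem_range.mp hi; omega), risingSeries,
    PowerSeries.coeff_mk]
  congr 2
  ring

end Expansion

/-! ### Hessenberg determinants -/

/-- A Hessenberg determinant computes the coefficients of the inverse of a unitriangular matrix. -/
theorem Matrix.det_hessenberg_eq {K : Type*} [CommRing K] (h : ℕ → ℕ → K) (h0 : ∀ i, h i 0 = 1)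
    (D : ℕ → K)
    (hD : ∀ n, ∑ i ∈ Finset.range (n + 1), D i * ((-1) ^ (n - i) * h i (n - i)) =
      if n = 0 then 1 else 0) (n : ℕ) :
    (Matrix.of fun i j : Fin n =>
      if (i : ℕ) ≤ (j : ℕ) + 1 then h i ((j : ℕ) + 1 - (i : ℕ)) else 0).det = D n := by
  set L : Matrix (Fin (n + 1)) (Fin (n + 1)) K :=
    Matrix.of fun i j => if (i : ℕ) ≤ j then h i ((j : ℕ) - i) else 0 with hL
  have hdet : L.det = 1 := by
    rw [Matrix.det_of_isUpperTriangular]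
    · simp [hL, h0]
    · intro i j hij
      simp only [id] at hij
      simp only [hL, Matrix.of_apply]
      exact if_neg (not_le.mpr hij)
  -- The signs turn the hypothesis on `D` into c L = e_0, so c is the first row of the inverse of L,
  -- which is its adjugate.
  set c : Fin (n + 1) → K := fun i => (-1) ^ (i : ℕ) * D i with hc
  have hcL : Matrix.vecMul c L = Pi.single 0 1 := by
    ext j
    have hj := hD j
    have e1 : Matrix.vecMul c L j = ∑ i ∈ Finset.range (n + 1),
        (-1) ^ i * D i * (if i ≤ (j : ℕ) then h i (j - i) else 0) := by
      rw [Finset.sum_range]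
      rfl
    have e2 : ∑ i ∈ Finset.range (n + 1),
        (-1) ^ i * D i * (if i ≤ (j : ℕ) then h i (j - i) else 0) =
        ∑ i ∈ Finset.range ((j : ℕ) + 1), (-1) ^ i * D i * h i (j - i) := by
      symm
      rw [← Finset.sum_subset (Finset.range_subset_range.mpr (Nat.succ_le_of_lt j.isLt))]
      · refine Finset.sum_congr rfl fun i hi => ?_
        rw [if_pos (Nat.lt_succ_iff.mp (Finset.mem_range.mp hi))]
      · intro i _ hi
        rw [if_neg (fun hle => hi (Finset.mem_range.mpr (Nat.lt_succ_of_le hle))), mul_zero]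
    have e3 : ∑ i ∈ Finset.range ((j : ℕ) + 1), (-1) ^ i * D i * h i (j - i) =
        (-1) ^ (j : ℕ) * ∑ i ∈ Finset.range ((j : ℕ) + 1),
          D i * ((-1) ^ ((j : ℕ) - i) * h i (j - i)) := by
      rw [Finset.mul_sum]
      refine Finset.sum_congr rfl fun i hi => ?_
      obtain ⟨m, hm⟩ := Nat.exists_eq_add_of_le (Nat.lt_succ_iff.mp (Finset.mem_range.mp hi))
      rw [hm, Nat.add_sub_cancel_left, pow_add]
      have : ((-1 : K) ^ m) * (-1) ^ m = 1 := by rw [← mul_pow]; simp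
      linear_combination (-(-1) ^ i * D i * h i m) * this
    rw [e1, e2, e3, hj]
    by_cases hj0 : j = 0
    · subst hj0
      simp
    · have : (j : ℕ) ≠ 0 := fun hh => hj0 (Fin.ext hh)
      simp [this, hj0]
  have hcn : c (Fin.last n) = L.adjugate 0 (Fin.last n) := by
    have : Matrix.vecMul (Matrix.vecMul c L) L.adjugate = c := by
      rw [Matrix.vecMul_vecMul, Matrix.mul_adjugate, hdet, one_smul, Matrix.vecMul_one]
    rw [hcL] at this
    rw [← this]
    simp
  rw [Matrix.adjugate_fin_succ_eq_det_submatrix] at hcn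
  -- Deleting the last row and first column of L shifts j to j + 1, which leaves the Hessenberg
  -- matrix.
  have hsub : L.submatrix (Fin.last n).succAbove (Fin.succAbove 0) =
      Matrix.of fun i j : Fin n =>
        if (i : ℕ) ≤ (j : ℕ) + 1 then h i ((j : ℕ) + 1 - (i : ℕ)) else 0 := by
    ext i j
    rw [Matrix.submatrix_apply, Fin.succAbove_last, Fin.succAbove_zero]
    rfl
  rw [hsub] at hcn
  simp only [hc, Fin.val_last, Fin.val_zero, add_zero] at hcn
  exact ((isUnit_one.neg.pow n).mul_left_cancel hcn).symm

/-! ### Nonnegativity of the determinant -/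

/-- The polynomials with nonnegative coefficients. -/
def nonnegCoeffSubsemiring : Subsemiring ℝ[X] where
  carrier := {p | ∀ k, 0 ≤ p.coeff k}
  zero_mem' := by simp
  one_mem' := fun k => by
    rw [coeff_one]
    split_ifs <;> norm_num
  add_mem' := fun ha hb k => by
    rw [coeff_add]
    exact add_nonneg (ha k) (hb k)
  mul_mem' := fun ha hb k => by
    rw [coeff_mul]
    exact Finset.sum_nonneg fun ij _ => mul_nonneg (ha _) (hb _)

lemma C_mem_nonnegCoeffSubsemiring {r : ℝ} (hr : 0 ≤ r) : C r ∈ nonnegCoeffSubsemiring := by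
  intro k
  rw [coeff_C]
  split_ifs <;> simp [hr]

lemma X_mem_nonnegCoeffSubsemiring : (X : ℝ[X]) ∈ nonnegCoeffSubsemiring := by
  intro k
  rw [coeff_X]
  split_ifs <;> norm_num

lemma algebraMap_rat_polynomial (r : ℚ) : algebraMap ℚ ℝ[X] r = C (r : ℝ) := by
  rw [IsScalarTower.algebraMap_apply ℚ ℝ ℝ[X]]
  rfl

theorem coeff_magicDet_nonneg {n : ℕ} (y : Fin n → ℤ) (hy : ∀ i, 0 < y i) (k : ℕ) :
    0 ≤ (magicDet y).coeff k := by
  -- The expansion needs infinitely many exponents; padding by 0 keeps them nonnegative.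
  set δ : ℕ → ℝ := fun i => if hi : i < n then (y ⟨i, hi⟩ : ℝ) - 1 else 0 with hδ
  have hδ0 : ∀ i, 0 ≤ δ i := by
    intro i
    simp only [hδ]
    split_ifs with hi
    · have : (1 : ℝ) ≤ y ⟨i, hi⟩ := by exact_mod_cast hy ⟨i, hi⟩
      linarith
    · exact le_rfl
  set ε : ℕ → ℝ[X] := fun i => X * C (δ i)
  have hq : (1 - X : ℝ[X]) ≠ 0 := by
    intro h
    have := congrArg (eval 0) h
    simp at this
  -- Left unsimplified, as q + t + i t + ∑ ε_m with q = 1 - X and t = X, to match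
  -- `sum_expansionCoeff_mul_risingCoeff`.
  set u : ℕ → ℝ[X] := fun i =>
    1 - X + X + (i : ℝ[X]) * X + ∑ m ∈ Finset.range (i + 1), ε m with hu
  have hui : ∀ i : Fin n, u i = 1 + X * C ((partialSum y i : ℝ) - 1) := by
    intro i
    have hsum : (partialSum y i : ℝ) = ∑ m ∈ Finset.range ((i : ℕ) + 1), (δ m + 1) := by
      rw [partialSum, Int.cast_sum]
      refine Finset.sum_bij (fun a _ => (a : ℕ)) ?_ ?_ ?_ ?_
      · intro a ha
        have : (a : ℕ) ≤ i := Fin.le_def.mp (Finset.mem_Iic.mp ha)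
        exact Finset.mem_range.mpr (by omega)
      · intro a _ b _ hab
        exact Fin.ext hab
      · intro b hb
        have hb' := Finset.mem_range.mp hb
        exact ⟨⟨b, by omega⟩, Finset.mem_Iic.mpr (Fin.le_def.mpr (by simp only; omega)), rfl⟩
      · intro a _
        simp [hδ]
    have h2 : (partialSum y i : ℝ) - 1 = ∑ m ∈ Finset.range ((i : ℕ) + 1), δ m + (i : ℕ) := by
      rw [hsum, Finset.sum_add_distrib]
      simp
      ring
    rw [h2, hu, map_add, map_sum]
    simp only [ε]
    rw [← Finset.mul_sum, map_natCast]
    ring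
  have hdet := Matrix.det_hessenberg_eq
    (fun i d => (-1) ^ d * risingCoeff (1 - X : ℝ[X]) (-u i) d) (by simp)
    (expansionCoeff (1 - X) X ε) (by
      intro n
      rw [← sum_expansionCoeff_mul_risingCoeff (t := X) (ε := ε) hq n]
      refine Finset.sum_congr rfl fun i _ => ?_
      rw [← mul_assoc ((-1) ^ (n - i)), ← mul_pow, neg_one_mul, neg_neg, one_pow, one_mul]) n
  have hmat : magicMatrix y = Matrix.of fun i j : Fin n =>
      if (i : ℕ) ≤ (j : ℕ) + 1 then (-1) ^ ((j : ℕ) + 1 - (i : ℕ)) *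
        risingCoeff (1 - X : ℝ[X]) (-u i) ((j : ℕ) + 1 - (i : ℕ)) else 0 := by
    ext1 i j
    simp only [magicMatrix, Matrix.of_apply]
    split_ifs with hij
    · set d := (j : ℕ) + 1 - (i : ℕ)
      rw [risingCoeff, algebraMap_rat_polynomial, mul_left_comm]
      push_cast
      congr 1
      rw [← Finset.card_range d, ← Finset.prod_const, Finset.card_range,
        ← Finset.prod_mul_distrib]
      refine Finset.prod_congr rfl fun ℓ _ => ?_
      rw [hui]
      simp only [map_sub, map_add, map_one, map_natCast]
      ring
    · rfl
  rw [magicDet, hmat, hdet]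
  refine expansionCoeff_mem nonnegCoeffSubsemiring (fun r hr => ?_) X_mem_nonnegCoeffSubsemiring
    ?_ (fun i => ?_) n k
  · rw [algebraMap_rat_polynomial]
    exact C_mem_nonnegCoeffSubsemiring (by exact_mod_cast hr)
  · rw [sub_add_cancel]
    exact Subsemiring.one_mem _
  · exact Subsemiring.mul_mem _ X_mem_nonnegCoeffSubsemiring (C_mem_nonnegCoeffSubsemiring (hδ0 i))

/-! ### The magic transform -/

lemma sum_range_C_ite_mul (d : ℕ) (a b : ℝ) (c : ℕ → ℝ) (F : ℕ → ℝ[X]) :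
    ∑ i ∈ Finset.range (d + 2),
      C ((if i ≤ d then b * c i else 0) + (if i = 0 then 0 else a * c (i - 1))) * F i =
    ∑ i ∈ Finset.range (d + 1), C (b * c i) * F i +
      ∑ i ∈ Finset.range (d + 1), C (a * c i) * F (i + 1) := by
  simp only [map_add C, add_mul, Finset.sum_add_distrib]
  congr 1
  · rw [Finset.sum_range_succ, if_neg (by omega), map_zero, zero_mul, add_zero]
    refine Finset.sum_congr rfl fun i hi => ?_
    rw [if_pos (Nat.lt_succ_iff.mp (Finset.mem_range.mp hi))]
  · rw [Finset.sum_range_succ']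
    simp

/-- The transform replaces 1 + t by 1 in a form homogeneous in t and 1 + t, so it respects products
with linear forms. -/
lemma IsMagicTransform.mul_linear {d : ℕ} {p q : ℝ[X]} (h : IsMagicTransform d p q) (a b : ℝ) :
    IsMagicTransform (d + 1) ((C a * X + C b * (1 + X)) * p) ((C a * X + C b) * q) := by
  obtain ⟨c, rfl, rfl⟩ := h
  refine ⟨fun i => (if i ≤ d then b * c i else 0) + (if i = 0 then 0 else a * c (i - 1)), ?_, ?_⟩
  · simp only [mul_assoc (C _) (X ^ _)]
    rw [sum_range_C_ite_mul d a b c fun i => X ^ i * (1 + X) ^ (d + 1 - i),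
      ← Finset.sum_add_distrib, Finset.mul_sum]
    refine Finset.sum_congr rfl fun i hi => ?_
    rw [Nat.succ_sub (Nat.lt_succ_iff.mp (Finset.mem_range.mp hi)), Nat.add_sub_add_right,
      map_mul, map_mul, pow_succ (1 + X)]
    ring
  · rw [sum_range_C_ite_mul d a b c fun i => X ^ i, ← Finset.sum_add_distrib, Finset.mul_sum]
    refine Finset.sum_congr rfl fun i _ => ?_
    rw [map_mul, map_mul]
    ring

lemma IsMagicTransform.C_mul {d : ℕ} {p q : ℝ[X]} (h : IsMagicTransform d p q) (a : ℝ) :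
    IsMagicTransform d (C a * p) (C a * q) := by
  obtain ⟨c, rfl, rfl⟩ := h
  refine ⟨fun i => a * c i, ?_, ?_⟩ <;>
  · rw [Finset.mul_sum]
    refine Finset.sum_congr rfl fun i _ => ?_
    rw [map_mul]
    ring

lemma isMagicTransform_prod (d : ℕ) (a b : ℕ → ℝ) :
    IsMagicTransform d (∏ ℓ ∈ Finset.range d, (C (a ℓ) * X + C (b ℓ) * (1 + X)))
      (∏ ℓ ∈ Finset.range d, (C (a ℓ) * X + C (b ℓ))) := by
  induction d with
  | zero => exact ⟨fun _ => 1, by simp, by simp⟩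
  | succ d ih =>
    rw [Finset.prod_range_succ, Finset.prod_range_succ, mul_comm, mul_comm (Finset.prod _ _)]
    exact ih.mul_linear (a d) (b d)

theorem isMagicTransform_pitmanStanleyEntry {n : ℕ} (y : Fin n → ℤ) (i j : Fin n) :
    IsMagicTransform ((j : ℕ) + 1 - (i : ℕ)) (pitmanStanleyEntry y i j) (magicMatrix y i j) := by
  simp only [pitmanStanleyEntry, magicMatrix, Matrix.of_apply]
  split_ifs with hij
  -- With s the partial sum, s t + 1 - ℓ = (s - 1 + ℓ) t + (1 - ℓ)(1 + t).
  · have h := (isMagicTransform_prod ((j : ℕ) + 1 - (i : ℕ))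
      (fun ℓ => (partialSum y i : ℝ) - 1 + ℓ) (fun ℓ => 1 - ℓ)).C_mul
      ((((j : ℕ) + 1 - (i : ℕ)).factorial : ℝ)⁻¹)
    convert h using 1
    · rw [binomialPoly]
      congr 1
      refine Finset.prod_congr rfl fun ℓ _ => ?_
      simp only [map_sub, map_add, map_one, map_natCast, Int.cast_one]
      ring
    · congr 1
      refine Finset.prod_congr rfl fun ℓ _ => ?_
      ring
  · exact ⟨0, by simp, by simp⟩

theorem mainTheorem9 (n : ℕ) (y : Fin n → ℤ) (hy : ∀ i, 0 < y i) :
    (∀ i j : Fin n,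
      IsMagicTransform ((j : ℕ) + 1 - (i : ℕ)) (pitmanStanleyEntry y i j) (magicMatrix y i j)) ∧
    (∀ k : ℕ, 0 ≤ (magicDet y).coeff k) :=
  ⟨isMagicTransform_pitmanStanleyEntry y, coeff_magicDet_nonneg y hy⟩
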